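/- Let $\mathbb{H}^3=\{(x_1,x_2,x_3)\in\mathbb{R}^3 : x_3>0\}$ carry the hyperbolic metric $x_3^{-2}(dx_1^2+dx_2^2+dx_3^2)$. Let $\gamma:[0,\infty)\to\mathbb{H}^3$, $\gamma(s)=(\gamma_1(s),0,\gamma_2(s))$, be a smooth curve with $\gamma_1>0$ and $\gamma_2>0$, parametrized by hyperbolic arc length, and let $E$ be the end of revolution generated by $\gamma$, i.e. the surface with boundary $[0,\infty)\times S^1$ ($S^1=\mathbb{R}/2\pi\mathbb{Z}$) immersed in $\mathbb{H}^3$ by $$f(s,\theta)=(\gamma_1(s)\cos\theta,\ \gamma_1(s)\sin\theta,\ \gamma_2(s))$$ and endowed with the metric induced from $\mathbb{H}^3$. Let $c>0$ and let $$I_+=\Big\{s\in[0,\infty) : \frac{\gamma_2(s)}{\gamma_1(s)}\ge c\Big\}$$ be the set of arc length parameters at which $\gamma$ lies on or above the $c$-cone. If $I_+$ has infinite Lebesgue measure, $\int_{I_+}ds=\infty$, then $E$ is parabolic: every bounded harmonic function on $E$ is determined by its boundary values, that is, if $u,v:E\to\mathbb{R}$ are bounded, continuous on $E$, and $C^2$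 with $\Delta_E u=\Delta_E v=0$ in the interior of $E$, where $\Delta_E$ is the Laplace–Beltrami operator of the induced metric, and if $u=v$ on $\partial E=\{0\}\times S^1$, then $u=v$ on $E$. -/

import Mathlib

open MeasureTheory Set
open scoped ContDiff

noncomputable section

/-- The Riemannian metric `(dx₁² + dx₂² + dx₃²) / x₃²` of the upper half-space model
`{x ∈ ℝ³ | x₃ > 0}` of hyperbolic 3-space, at the point `p`, on the tangent vectors `v`, `w`. -/
def hypMetric (p v w : EuclideanSpace ℝ (Fin 3)) : ℝ :=
  inner ℝ v w / (p 2) ^ 2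

/-- The coordinate vector fields `∂/∂s`, `∂/∂θ` of the parameter plane. -/
def coordVec (i : Fin 2) : ℝ × ℝ := ![((1 : ℝ), (0 : ℝ)), (0, 1)] i

/-- Partial derivatives with respect to the coordinates `(s, θ)`. -/
def coordDeriv {F : Type*} [NormedAddCommGroup F] [NormedSpace ℝ F]
    (i : Fin 2) (f : ℝ × ℝ → F) (q : ℝ × ℝ) : F :=
  fderiv ℝ f q (coordVec i)

/-- The components `g_{ij} = ⟨∂ᵢX, ∂ⱼX⟩` of the metric that a parametrized surface `X` inherits
from hyperbolic 3-space. -/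
def inducedMetric (X : ℝ × ℝ → EuclideanSpace ℝ (Fin 3)) (q : ℝ × ℝ) :
    Matrix (Fin 2) (Fin 2) ℝ :=
  Matrix.of fun i j => hypMetric (X q) (coordDeriv i X q) (coordDeriv j X q)

/-- The Laplace–Beltrami operator of a metric `g` in coordinates,
`Δφ = (det g)^{-1/2} ∑ᵢ ∂ᵢ ((det g)^{1/2} ∑ⱼ g^{ij} ∂ⱼφ)`. -/
def laplaceBeltrami (g : ℝ × ℝ → Matrix (Fin 2) (Fin 2) ℝ) (φ : ℝ × ℝ → ℝ) (q : ℝ × ℝ) : ℝ :=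
  (Real.sqrt (g q).det)⁻¹ *
    ∑ i : Fin 2, coordDeriv i
      (fun x => Real.sqrt (g x).det * ∑ j : Fin 2, (g x)⁻¹ i j * coordDeriv j φ x) q

/-- The curve `s ↦ (γ₁ s, 0, γ₂ s)` in the `(x₁, x₃)`-plane. -/
def planeCurve (γ₁ γ₂ : ℝ → ℝ) (s : ℝ) : EuclideanSpace ℝ (Fin 3) :=
  !₂[γ₁ s, 0, γ₂ s]

/-- A complete end of revolution in hyperbolic 3-space (upper half-space model) about the geodesic
`{x₁ = x₂ = 0}`, given by its smooth generating curve `γ : [0, ∞) → ℍ²`,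
`γ s = (γ₁ s, 0, γ₂ s)`, which does not meet the axis and is parametrized by hyperbolic
arc length. Only the values at parameters `s ≥ 0` are meaningful. -/
structure EndOfRevolution where
  γ₁ : ℝ → ℝ
  γ₂ : ℝ → ℝ
  smooth₁ : ContDiffOn ℝ ∞ γ₁ (Ici 0)
  smooth₂ : ContDiffOn ℝ ∞ γ₂ (Ici 0)
  pos₁ : ∀ s, 0 ≤ s → 0 < γ₁ s
  pos₂ : ∀ s, 0 ≤ s → 0 < γ₂ s
  arclength : ∀ s, 0 ≤ s →
    hypMetric (planeCurve γ₁ γ₂ s)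
      (derivWithin (planeCurve γ₁ γ₂) (Ici 0) s)
      (derivWithin (planeCurve γ₁ γ₂) (Ici 0) s) = 1

/-- The surface with boundary `[0, ∞) × S¹` underlying an end of revolution, where
`S¹ = ℝ / 2πℤ`. -/
abbrev HalfCylinder : Type := Ici (0 : ℝ) × Real.Angle

/-- The boundary circle `{0} × S¹`. -/
def HalfCylinder.boundary : Set HalfCylinder := {p | (p.1 : ℝ) = 0}

/-- A function on `[0, ∞) × S¹` in the coordinates `(s, θ)`. The values for `s < 0` are
irrelevant. -/
def HalfCylinder.lift (u : HalfCylinder → ℝ) (q : ℝ × ℝ) : ℝ :=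
  u (projIci 0 q.1, (q.2 : Real.Angle))

namespace EndOfRevolution

/-- The rotation of the generating curve about the `x₃`-axis, in the coordinates `(s, θ)`. -/
def param (E : EndOfRevolution) (q : ℝ × ℝ) : EuclideanSpace ℝ (Fin 3) :=
  !₂[E.γ₁ q.1 * Real.cos q.2, E.γ₁ q.1 * Real.sin q.2, E.γ₂ q.1]

/-- A harmonic function on the end: it is continuous on the whole end (boundary included), and in
the interior it is `C²` and its Laplacian with respect to the inherited metric vanishes. -/
structure IsHarmonic (E : EndOfRevolution) (u : HalfCylinder → ℝ) : Prop where
  continuous : Continuous u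
  contDiffOn : ContDiffOn ℝ 2 (HalfCylinder.lift u) (Ioi (0 : ℝ) ×ˢ (univ : Set ℝ))
  laplacian_eq_zero : ∀ s θ : ℝ, 0 < s →
    laplaceBeltrami (inducedMetric E.param) (HalfCylinder.lift u) (s, θ) = 0

/-- An end is parabolic if every bounded harmonic function on it is determined by its boundary
values. -/
def IsParabolic (E : EndOfRevolution) : Prop :=
  ∀ u v : HalfCylinder → ℝ,
    E.IsHarmonic u → (∃ C : ℝ, ∀ p, |u p| ≤ C) →
    E.IsHarmonic v → (∃ C : ℝ, ∀ p, |v p| ≤ C) →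
    EqOn u v HalfCylinder.boundary → u = v

/-- The set `I₊` of arc length parameters at which the generating curve lies on or above the
`c`-cone `{x₃ = c √(x₁² + x₂²)}`. -/
def aboveCone (E : EndOfRevolution) (c : ℝ) : Set ℝ :=
  {s | 0 ≤ s ∧ c ≤ E.γ₂ s / E.γ₁ s}

end EndOfRevolution

end

open Filter Topology

/-! In arc length the induced metric is `ds² + r² dθ²` with `r = γ₁ / γ₂`, so `h(s) = ∫₀ˢ dt / r`
(`potential`) is harmonic. On `I₊` one has `1 / r ≥ c`, hence `h → ∞` (`exists_le_potential`). If
`w` is the difference of two bounded harmonic functions with equal boundary values, then for large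
`R` the function `ε h` dominates `w` on both edges of `[0, R] × S¹`, hence inside by the maximum
principle (`le_mul_potential`); small `ε` gives `w ≤ 0`. Strictness in the maximum principle comes
from adding `δ h²`, since `Δ(h²) = 2 / r² > 0`. -/

/-- At a local maximum of `f` where `f' = k / r` with `r > 0`, the derivative of `k` is
nonpositive. -/
theorem IsLocalMax.weighted_second_deriv_nonpos {f k r : ℝ → ℝ} {a d : ℝ} (hf : IsLocalMax f a)
    (hf' : ∀ᶠ x in 𝓝 a, HasDerivAt f (k x / r x) x) (hr : ∀ᶠ x in 𝓝 a, 0 < r x)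
    (hk : HasDerivAt k d a) : d ≤ 0 := by
  by_contra! hd
  have hka : k a = 0 := by
    have h0 := hf.hasDerivAt_eq_zero hf'.self_of_nhds
    have hra := hr.self_of_nhds
    rcases div_eq_zero_iff.1 h0 with h | h
    · exact h
    · exact absurd h hra.ne'
  -- Since `k a = 0` and `k' a > 0`, both `k` and `f' = k / r` are positive just right of `a`, so
  -- `f` increases away from its maximum.
  have hpos : ∀ᶠ x in 𝓝[>] a, 0 < k x := by
    have hs := (hasDerivAt_iff_tendsto_slope.1 hk).eventually (lt_mem_nhds hd)
    have hs' : ∀ᶠ x in 𝓝[>] a, 0 < slope k a x :=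
      hs.filter_mono (nhdsWithin_mono a fun x (hx : a < x) => hx.ne')
    filter_upwards [hs', self_mem_nhdsWithin] with x hx hax
    rw [slope_def_field, hka, sub_zero] at hx
    exact (div_pos_iff_of_pos_right (sub_pos.2 hax)).1 hx
  have hall : ∀ᶠ x in 𝓝[>] a, 0 < k x ∧ HasDerivAt f (k x / r x) x ∧ 0 < r x ∧ f x ≤ f a :=
    hpos.and ((hf'.filter_mono nhdsWithin_le_nhds).and
      ((hr.filter_mono nhdsWithin_le_nhds).and (hf.filter_mono nhdsWithin_le_nhds)))
  obtain ⟨b, hab, hb⟩ := (mem_nhdsGT_iff_exists_Ioc_subset).1 hall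
  have hmono : StrictMonoOn f (Icc a b) := by
    apply strictMonoOn_of_deriv_pos (convex_Icc a b)
    · intro x hx
      rcases hx.1.eq_or_lt with rfl | h
      · exact hf'.self_of_nhds.continuousAt.continuousWithinAt
      · exact (hb ⟨h, hx.2⟩).2.1.continuousAt.continuousWithinAt
    · intro x hx
      rw [interior_Icc] at hx
      obtain ⟨h1, h2, h3, -⟩ := hb ⟨hx.1, hx.2.le⟩
      rw [h2.deriv]
      exact div_pos h1 h3
  have h1 := hmono (left_mem_Icc.2 (le_of_lt hab)) (right_mem_Icc.2 (le_of_lt hab)) hab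
  exact absurd (hb ⟨hab, le_rfl⟩).2.2.2 (not_le.2 h1)

/-! ### Partial derivatives in the coordinates `(s, θ)`. -/

section CoordDeriv

variable {F : Type*} [NormedAddCommGroup F] [NormedSpace ℝ F]

theorem hasDerivAt_coordDeriv_zero {f : ℝ × ℝ → F} {s θ : ℝ} (hf : DifferentiableAt ℝ f (s, θ)) :
    HasDerivAt (fun t => f (t, θ)) (coordDeriv 0 f (s, θ)) s := by
  have h : HasDerivAt (fun t : ℝ => (t, θ)) ((1 : ℝ), (0 : ℝ)) s :=
    (hasDerivAt_id s).prodMk (hasDerivAt_const s θ)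
  exact HasFDerivAt.comp_hasDerivAt (f := fun t : ℝ => (t, θ)) s hf.hasFDerivAt h

theorem hasDerivAt_coordDeriv_one {f : ℝ × ℝ → F} {s θ : ℝ} (hf : DifferentiableAt ℝ f (s, θ)) :
    HasDerivAt (fun t => f (s, t)) (coordDeriv 1 f (s, θ)) θ := by
  have h : HasDerivAt (fun t : ℝ => (s, t)) ((0 : ℝ), (1 : ℝ)) θ :=
    (hasDerivAt_const θ s).prodMk (hasDerivAt_id θ)
  exact HasFDerivAt.comp_hasDerivAt (f := fun t : ℝ => (s, t)) θ hf.hasFDerivAt h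

theorem coordDeriv_congr {f g : ℝ × ℝ → F} {q : ℝ × ℝ} (h : f =ᶠ[𝓝 q] g) (i : Fin 2) :
    coordDeriv i f q = coordDeriv i g q := by
  unfold coordDeriv
  rw [h.fderiv_eq]

theorem coordDeriv_sub {f g : ℝ × ℝ → F} {q : ℝ × ℝ} (hf : DifferentiableAt ℝ f q)
    (hg : DifferentiableAt ℝ g q) (i : Fin 2) :
    coordDeriv i (fun x => f x - g x) q = coordDeriv i f q - coordDeriv i g q := by
  unfold coordDeriv
  rw [fderiv_fun_sub hf hg]
  rfl

theorem differentiableAt_coordDeriv {f : ℝ × ℝ → F} {q : ℝ × ℝ} (hf : ContDiffAt ℝ 2 f q)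
    (i : Fin 2) : DifferentiableAt ℝ (coordDeriv i f) q := by
  have h : ContDiffAt ℝ 1 (fderiv ℝ f) q := hf.fderiv_right (by norm_num)
  exact (h.differentiableAt (by norm_num)).clm_apply (differentiableAt_const _)

end CoordDeriv

theorem hasDerivAt_vec3 {a b c : ℝ → ℝ} {a' b' c' s : ℝ} (ha : HasDerivAt a a' s)
    (hb : HasDerivAt b b' s) (hc : HasDerivAt c c' s) :
    HasDerivAt (fun t => (!₂[a t, b t, c t] : EuclideanSpace ℝ (Fin 3))) !₂[a', b', c'] s := by
  have h : HasDerivAt (fun t => ![a t, b t, c t]) ![a', b', c'] s := by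
    rw [hasDerivAt_pi]
    intro i
    fin_cases i
    · exact ha
    · exact hb
    · exact hc
  exact (PiLp.continuousLinearEquiv 2 ℝ fun _ : Fin 3 => ℝ).symm.hasFDerivAt.comp_hasDerivAt s h

theorem isOpen_halfPlane : IsOpen (Ioi (0 : ℝ) ×ˢ (univ : Set ℝ)) := isOpen_Ioi.prod isOpen_univ

theorem eventually_fst_pos {q : ℝ × ℝ} (hq : 0 < q.1) : ∀ᶠ x : ℝ × ℝ in 𝓝 q, 0 < x.1 :=
  continuous_fst.continuousAt.eventually (lt_mem_nhds hq)

theorem HalfCylinder.lift_coe (u : HalfCylinder → ℝ) (s : Ici (0 : ℝ)) (θ : ℝ) :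
    HalfCylinder.lift u (s, θ) = u (s, (θ : Real.Angle)) := by
  simp [HalfCylinder.lift, projIci_coe]

/-! ### Induced metric and Laplacian of an end of revolution. -/

namespace EndOfRevolution

variable (E : EndOfRevolution)

/-- The hyperbolic circumference, divided by `2π`, of the parallel at parameter `s`. -/
noncomputable def radius (s : ℝ) : ℝ := E.γ₁ s / E.γ₂ s

theorem radius_pos {s : ℝ} (hs : 0 ≤ s) : 0 < E.radius s := div_pos (E.pos₁ s hs) (E.pos₂ s hs)

theorem differentiableAt_γ₁ {s : ℝ} (hs : 0 < s) : DifferentiableAt ℝ E.γ₁ s :=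
  (E.smooth₁.contDiffAt (Ici_mem_nhds hs)).differentiableAt (by simp)

theorem differentiableAt_γ₂ {s : ℝ} (hs : 0 < s) : DifferentiableAt ℝ E.γ₂ s :=
  (E.smooth₂.contDiffAt (Ici_mem_nhds hs)).differentiableAt (by simp)

theorem differentiableAt_radius {s : ℝ} (hs : 0 < s) : DifferentiableAt ℝ E.radius s :=
  (E.differentiableAt_γ₁ hs).div (E.differentiableAt_γ₂ hs) (E.pos₂ s hs.le).ne'

theorem differentiableAt_radius_fst {q : ℝ × ℝ} (hq : 0 < q.1) :
    DifferentiableAt ℝ (fun x : ℝ × ℝ => E.radius x.1) q :=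
  (E.differentiableAt_radius hq).comp q differentiableAt_fst

theorem continuousOn_radius : ContinuousOn E.radius (Ici 0) :=
  E.smooth₁.continuousOn.div E.smooth₂.continuousOn fun s hs => (E.pos₂ s hs).ne'

theorem deriv_sq_add_deriv_sq {s : ℝ} (hs : 0 < s) :
    deriv E.γ₁ s ^ 2 + deriv E.γ₂ s ^ 2 = E.γ₂ s ^ 2 := by
  have hd : HasDerivAt (planeCurve E.γ₁ E.γ₂) !₂[deriv E.γ₁ s, 0, deriv E.γ₂ s] s :=
    hasDerivAt_vec3 (E.differentiableAt_γ₁ hs).hasDerivAt (hasDerivAt_const s 0)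
      (E.differentiableAt_γ₂ hs).hasDerivAt
  have h := E.arclength s hs.le
  rw [derivWithin_of_mem_nhds (Ici_mem_nhds hs), hd.deriv] at h
  have h2 := E.pos₂ s hs.le
  simp only [hypMetric, planeCurve, PiLp.inner_apply, Fin.sum_univ_three] at h
  simp only [Matrix.cons_val, RCLike.inner_apply, conj_trivial] at h
  rw [div_eq_one_iff_eq (by positivity)] at h
  linarith

theorem differentiableAt_param {q : ℝ × ℝ} (hq : 0 < q.1) : DifferentiableAt ℝ E.param q := by
  have h1 : DifferentiableAt ℝ (fun x : ℝ × ℝ => E.γ₁ x.1) q :=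
    (E.differentiableAt_γ₁ hq).comp q differentiableAt_fst
  have h2 : DifferentiableAt ℝ (fun x : ℝ × ℝ => E.γ₂ x.1) q :=
    (E.differentiableAt_γ₂ hq).comp q differentiableAt_fst
  rw [differentiableAt_euclidean]
  intro i
  fin_cases i
  · exact h1.mul (Real.differentiable_cos.differentiableAt.comp q differentiableAt_snd)
  · exact h1.mul (Real.differentiable_sin.differentiableAt.comp q differentiableAt_snd)
  · exact h2

theorem coordDeriv_zero_param {s θ : ℝ} (hs : 0 < s) :
    coordDeriv 0 E.param (s, θ) =
      !₂[deriv E.γ₁ s * Real.cos θ, deriv E.γ₁ s * Real.sin θ, deriv E.γ₂ s] :=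
  (hasDerivAt_coordDeriv_zero (E.differentiableAt_param (q := (s, θ)) hs)).unique
    (hasDerivAt_vec3 ((E.differentiableAt_γ₁ hs).hasDerivAt.mul_const (Real.cos θ))
      ((E.differentiableAt_γ₁ hs).hasDerivAt.mul_const (Real.sin θ)) (E.differentiableAt_γ₂ hs).hasDerivAt)

theorem coordDeriv_one_param {s θ : ℝ} (hs : 0 < s) :
    coordDeriv 1 E.param (s, θ) =
      !₂[E.γ₁ s * -Real.sin θ, E.γ₁ s * Real.cos θ, 0] :=
  (hasDerivAt_coordDeriv_one (E.differentiableAt_param (q := (s, θ)) hs)).unique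
    (hasDerivAt_vec3 ((Real.hasDerivAt_cos θ).const_mul (E.γ₁ s))
      ((Real.hasDerivAt_sin θ).const_mul (E.γ₁ s)) (hasDerivAt_const θ (E.γ₂ s)))

theorem inducedMetric_param {q : ℝ × ℝ} (hq : 0 < q.1) :
    inducedMetric E.param q = !![1, 0; 0, E.radius q.1 ^ 2] := by
  obtain ⟨s, θ⟩ := q
  have hsq := E.deriv_sq_add_deriv_sq hq
  have h2 := E.pos₂ s (le_of_lt hq)
  have hcs := Real.sin_sq_add_cos_sq θ
  ext i j
  fin_cases i <;> fin_cases j <;>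
    simp [inducedMetric, hypMetric, E.coordDeriv_zero_param hq, E.coordDeriv_one_param hq, param,
      PiLp.inner_apply, Fin.sum_univ_three, radius]
  · rw [div_eq_one_iff_eq (by positivity)]
    linear_combination hsq + deriv E.γ₁ s ^ 2 * hcs
  · left; ring
  · left; ring
  · rw [div_pow]
    congr 1
    linear_combination E.γ₁ s ^ 2 * hcs

/-- Here `√det g = r` and `g⁻¹ = diag(1, r⁻²)`. These are differentiated, so they are needed on a
neighbourhood of `q`. -/
theorem laplaceBeltrami_eq (φ : ℝ × ℝ → ℝ) {q : ℝ × ℝ} (hq : 0 < q.1) :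
    laplaceBeltrami (inducedMetric E.param) φ q = (E.radius q.1)⁻¹ *
      (coordDeriv 0 (fun x => E.radius x.1 * coordDeriv 0 φ x) q +
        coordDeriv 1 (fun x => (E.radius x.1)⁻¹ * coordDeriv 1 φ x) q) := by
  have hdet : ∀ x : ℝ × ℝ, 0 < x.1 →
      Real.sqrt (inducedMetric E.param x).det = E.radius x.1 := by
    intro x hx
    rw [E.inducedMetric_param hx, Matrix.det_fin_two_of]
    simp [Real.sqrt_sq (E.radius_pos (le_of_lt hx)).le]
  have hinv : ∀ x : ℝ × ℝ, 0 < x.1 →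
      (inducedMetric E.param x)⁻¹ = !![1, 0; 0, (E.radius x.1 ^ 2)⁻¹] := by
    intro x hx
    have := (E.radius_pos (le_of_lt hx)).ne'
    rw [E.inducedMetric_param hx]
    apply Matrix.inv_eq_right_inv
    ext i j
    fin_cases i <;> fin_cases j <;> simp [Matrix.mul_apply, this]
  rw [laplaceBeltrami, hdet q hq, Fin.sum_univ_two]
  congr 2
  · apply coordDeriv_congr
    filter_upwards [eventually_fst_pos hq] with x hx
    rw [hdet x hx, hinv x hx]
    simp
  · apply coordDeriv_congr
    filter_upwards [eventually_fst_pos hq] with x hx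
    have := (E.radius_pos (le_of_lt hx)).ne'
    rw [hdet x hx, hinv x hx]
    simp
    field_simp

/-! ### The potential and its divergence. -/

/-- The rotationally symmetric harmonic function `s ↦ ∫₀ˢ dt / radius t`. -/
noncomputable def potential (s : ℝ) : ℝ := ∫ t in (0 : ℝ)..s, (E.radius t)⁻¹

theorem continuousOn_inv_radius : ContinuousOn (fun t => (E.radius t)⁻¹) (Ici 0) :=
  E.continuousOn_radius.inv₀ fun _ hs => (E.radius_pos hs).ne'

theorem intervalIntegrable_inv_radius {a b : ℝ} (ha : 0 ≤ a) (hb : 0 ≤ b) :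
    IntervalIntegrable (fun t => (E.radius t)⁻¹) volume a b :=
  (E.continuousOn_inv_radius.mono fun _ hx => le_trans (le_min ha hb) hx.1).intervalIntegrable

theorem hasDerivAt_potential {s : ℝ} (hs : 0 < s) :
    HasDerivAt E.potential (E.radius s)⁻¹ s := by
  apply intervalIntegral.integral_hasDerivAt_right (E.intervalIntegrable_inv_radius le_rfl hs.le)
  · exact (E.continuousOn_inv_radius.mono Ioi_subset_Ici_self).stronglyMeasurableAtFilter
      isOpen_Ioi s hs
  · exact E.continuousOn_inv_radius.continuousAt (Ici_mem_nhds hs)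

theorem potential_zero : E.potential 0 = 0 := intervalIntegral.integral_same

theorem potential_mono {s t : ℝ} (hs : 0 ≤ s) (hst : s ≤ t) : E.potential s ≤ E.potential t := by
  have ht := hs.trans hst
  have h := intervalIntegral.integral_add_adjacent_intervals
    (E.intervalIntegrable_inv_radius le_rfl hs) (E.intervalIntegrable_inv_radius hs ht)
  have h2 : 0 ≤ ∫ x in s..t, (E.radius x)⁻¹ :=
    intervalIntegral.integral_nonneg hst fun x hx =>
      (inv_pos.2 (E.radius_pos (hs.trans hx.1))).le
  simp only [potential]
  linarith

theorem potential_nonneg {s : ℝ} (hs : 0 ≤ s) : 0 ≤ E.potential s :=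
  E.potential_zero ▸ E.potential_mono le_rfl hs

/-- Continuity up to `s = 0` is needed to attain maxima on the compact piece `[0, R] × S¹`. -/
theorem continuousOn_potential : ContinuousOn E.potential (Ici 0) := by
  intro s hs
  have hs' : (0 : ℝ) ≤ s := hs
  have h : ContinuousOn E.potential (uIcc 0 (s + 1)) :=
    intervalIntegral.continuousOn_primitive_interval
      ((intervalIntegrable_iff' (by simp)).1
        (E.intervalIntegrable_inv_radius le_rfl (by linarith)))
  rw [uIcc_of_le (by linarith)] at h
  refine (h s ⟨hs', by linarith⟩).mono_of_mem_nhdsWithin ?_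
  rw [mem_nhdsWithin]
  exact ⟨Iio (s + 1), isOpen_Iio, by simp, fun x hx => ⟨hx.2, le_of_lt hx.1⟩⟩

theorem measurableSet_aboveCone (c : ℝ) : MeasurableSet (E.aboveCone c) := by
  have hc : ContinuousOn (fun s => E.γ₂ s / E.γ₁ s) (Ici 0) :=
    E.smooth₂.continuousOn.div E.smooth₁.continuousOn fun s hs => (E.pos₁ s hs).ne'
  exact (hc.preimage_isClosed_of_isClosed isClosed_Ici isClosed_Ici).measurableSet

/-- The cone condition says exactly that the integrand `1 / r` is at least `c`. -/
theorem mul_volume_le_potential (c : ℝ) {R : ℝ} (hR : 0 ≤ R) :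
    c * volume.real (E.aboveCone c ∩ Ioc 0 R) ≤ E.potential R := by
  have hint := (intervalIntegrable_iff_integrableOn_Ioc_of_le hR).1
    (E.intervalIntegrable_inv_radius le_rfl hR)
  have hm : MeasurableSet (E.aboveCone c ∩ Ioc 0 R) :=
    (E.measurableSet_aboveCone c).inter measurableSet_Ioc
  have hfin : volume (E.aboveCone c ∩ Ioc 0 R) ≠ ⊤ :=
    measure_ne_top_of_subset inter_subset_right measure_Ioc_lt_top.ne
  have h1 : ∫ _ in E.aboveCone c ∩ Ioc 0 R, c ≤
      ∫ t in E.aboveCone c ∩ Ioc 0 R, (E.radius t)⁻¹ := by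
    refine setIntegral_mono_on (integrableOn_const hfin) (hint.mono_set inter_subset_right) hm ?_
    intro t ht
    rw [radius, inv_div]
    exact ht.1.2
  have h2 : ∫ t in E.aboveCone c ∩ Ioc 0 R, (E.radius t)⁻¹ ≤
      ∫ t in Ioc 0 R, (E.radius t)⁻¹ := by
    refine setIntegral_mono_set hint ?_ inter_subset_right.eventuallyLE
    filter_upwards [self_mem_ae_restrict measurableSet_Ioc] with t ht
    exact (inv_pos.2 (E.radius_pos ht.1.le)).le
  rw [setIntegral_const, smul_eq_mul, mul_comm] at h1
  rw [potential, intervalIntegral.integral_of_le hR]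
  exact h1.trans h2

theorem exists_le_potential {c : ℝ} (hc : 0 < c) (hI : volume (E.aboveCone c) = ⊤) (M s : ℝ) :
    ∃ R, s ≤ R ∧ 0 ≤ R ∧ M ≤ E.potential R := by
  have hU : volume (⋃ n : ℕ, E.aboveCone c ∩ Ioc 0 (n : ℝ)) = ⊤ := by
    -- The half-open intervals miss only the parameter `0`, a null set.
    have hsub : E.aboveCone c ⊆ (⋃ n : ℕ, E.aboveCone c ∩ Ioc 0 (n : ℝ)) ∪ {0} := by
      intro t ht
      rcases ht.1.eq_or_lt with h | h
      · exact Or.inr h.symm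
      · obtain ⟨n, hn⟩ := exists_nat_ge t
        exact Or.inl (mem_iUnion.2 ⟨n, ht, h, hn⟩)
    have := (measure_mono hsub).trans (measure_union_le (μ := volume) _ _)
    rw [hI, Real.volume_singleton, add_zero] at this
    exact top_le_iff.1 this
  have hmono : Monotone fun n : ℕ => E.aboveCone c ∩ Ioc 0 (n : ℝ) := fun m n hmn =>
    inter_subset_inter_right _ (Ioc_subset_Ioc_right (Nat.cast_le.2 hmn))
  have ht := tendsto_measure_iUnion_atTop (μ := volume) hmono
  rw [hU] at ht
  obtain ⟨n, hn, hsn⟩ := ((ht.eventually (lt_mem_nhds (ENNReal.ofReal_lt_top (r := M / c)))).and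
    (eventually_ge_atTop ⌈s⌉₊)).exists
  refine ⟨n, (Nat.le_ceil s).trans (Nat.cast_le.2 hsn), n.cast_nonneg, ?_⟩
  refine le_trans ?_ (E.mul_volume_le_potential c n.cast_nonneg)
  have hfin : volume (E.aboveCone c ∩ Ioc 0 (n : ℝ)) ≠ ⊤ :=
    measure_ne_top_of_subset inter_subset_right measure_Ioc_lt_top.ne
  have := (ENNReal.ofReal_le_iff_le_toReal hfin).1 hn.le
  rw [div_le_iff₀ hc] at this
  rw [mul_comm]
  exact this

/-! ### Maximum principle for harmonic functions on the end. -/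

variable {E}

namespace IsHarmonic

variable {u v : HalfCylinder → ℝ}

theorem contDiffAt_lift (hu : E.IsHarmonic u) {q : ℝ × ℝ} (hq : 0 < q.1) :
    ContDiffAt ℝ 2 (HalfCylinder.lift u) q :=
  hu.contDiffOn.contDiffAt (isOpen_halfPlane.mem_nhds ⟨hq, mem_univ _⟩)

theorem sub (hu : E.IsHarmonic u) (hv : E.IsHarmonic v) : E.IsHarmonic (u - v) where
  continuous := hu.continuous.sub hv.continuous
  contDiffOn := hu.contDiffOn.sub hv.contDiffOn
  laplacian_eq_zero s θ hs := by
    have hq : 0 < ((s, θ) : ℝ × ℝ).1 := hs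
    have h1 := hu.laplacian_eq_zero s θ hs
    have h2 := hv.laplacian_eq_zero s θ hs
    rw [E.laplaceBeltrami_eq _ hq] at h1 h2 ⊢
    have hr : DifferentiableAt ℝ (fun x : ℝ × ℝ => E.radius x.1) (s, θ) :=
      E.differentiableAt_radius_fst (q := (s, θ)) hs
    have hr' : DifferentiableAt ℝ (fun x : ℝ × ℝ => (E.radius x.1)⁻¹) (s, θ) :=
      hr.inv (E.radius_pos hs.le).ne'
    have key : ∀ (i : Fin 2) (ρ : ℝ × ℝ → ℝ), DifferentiableAt ℝ ρ (s, θ) →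
        coordDeriv i (fun x => ρ x * coordDeriv i (HalfCylinder.lift (u - v)) x) (s, θ) =
          coordDeriv i (fun x => ρ x * coordDeriv i (HalfCylinder.lift u) x) (s, θ) -
          coordDeriv i (fun x => ρ x * coordDeriv i (HalfCylinder.lift v) x) (s, θ) := by
      intro i ρ hρ
      refine Eq.trans ?_
        (coordDeriv_sub (hρ.mul (differentiableAt_coordDeriv (hu.contDiffAt_lift hq) i))
          (hρ.mul (differentiableAt_coordDeriv (hv.contDiffAt_lift hq) i)) i)
      apply coordDeriv_congr
      filter_upwards [eventually_fst_pos hq] with x hx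
      rw [Pi.mul_apply, Pi.mul_apply, ← mul_sub, ← coordDeriv_sub ((hu.contDiffAt_lift hx).differentiableAt (by norm_num))
        ((hv.contDiffAt_lift hx).differentiableAt (by norm_num))]
      rfl
    rw [key 0 _ hr, key 1 _ hr']
    linear_combination h1 - h2

/-- A harmonic function plus the strictly subharmonic perturbation `-ε h + δ h²` of it, with `h`
the potential, has no interior local maximum. -/
theorem not_isLocalMax (hu : E.IsHarmonic u) {s θ ε δ : ℝ} (hs : 0 < s) (hδ : 0 < δ) :
    ¬ IsLocalMax (fun q : ℝ × ℝ => HalfCylinder.lift u q - ε * E.potential q.1 +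
      δ * E.potential q.1 ^ 2) (s, θ) := by
  intro hmax
  have hq : 0 < ((s, θ) : ℝ × ℝ).1 := hs
  have hρ := E.radius_pos hs.le
  have hr : DifferentiableAt ℝ (fun x : ℝ × ℝ => E.radius x.1) (s, θ) :=
    E.differentiableAt_radius_fst (q := (s, θ)) hs
  have hr' : DifferentiableAt ℝ (fun x : ℝ × ℝ => (E.radius x.1)⁻¹) (s, θ) :=
    hr.inv hρ.ne'
  have hA := hasDerivAt_coordDeriv_zero
    (hr.mul (differentiableAt_coordDeriv (hu.contDiffAt_lift hq) 0))
  have hB := hasDerivAt_coordDeriv_one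
    (hr'.mul (differentiableAt_coordDeriv (hu.contDiffAt_lift hq) 1))
  have hlap := hu.laplacian_eq_zero s θ hs
  rw [E.laplaceBeltrami_eq _ hq] at hlap
  have hsum := (mul_eq_zero.1 hlap).resolve_left (inv_pos.2 hρ).ne'
  have hmaxs := hmax.comp_continuous (g := fun t : ℝ => (t, θ)) (b := s)
    (by fun_prop)
  have hmaxθ := hmax.comp_continuous (g := fun t : ℝ => (s, t)) (b := θ)
    (by fun_prop)
  have hpot := E.hasDerivAt_potential hs
  -- As `r h' = 1`, the flux `r ∂ₛ` of the perturbed function is `r ∂ₛu - ε + 2δh`. In the `θ`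
  -- direction the perturbation is constant.
  have hdA := hmaxs.weighted_second_deriv_nonpos (r := E.radius)
    (k := fun t => E.radius t * coordDeriv 0 (HalfCylinder.lift u) (t, θ) - ε +
      2 * δ * E.potential t) ?_ ?_ ((hA.sub_const ε).add (hpot.const_mul (2 * δ)))
  · have hdB := hmaxθ.weighted_second_deriv_nonpos (r := fun _ => (E.radius s)⁻¹)
      (k := fun t => (E.radius s)⁻¹ * coordDeriv 1 (HalfCylinder.lift u) (s, t)) ?_ ?_ hB
    · have hpos : 0 < 2 * δ * (E.radius s)⁻¹ := by positivity
      simp only [Pi.mul_def] at hdA hdB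
      linarith
    · refine Eventually.of_forall fun t => ?_
      have hd := hasDerivAt_coordDeriv_one (s := s) (θ := t)
        ((hu.contDiffAt_lift (q := (s, t)) hs).differentiableAt (by norm_num))
      rw [mul_div_cancel_left₀ _ (inv_pos.2 hρ).ne']
      exact (hd.sub_const (ε * E.potential s)).add_const (δ * E.potential s ^ 2)
    · exact Eventually.of_forall fun _ => inv_pos.2 hρ
  · filter_upwards [lt_mem_nhds hs] with t ht
    have hd := hasDerivAt_coordDeriv_zero (s := t) (θ := θ)
      ((hu.contDiffAt_lift (q := (t, θ)) ht).differentiableAt (by norm_num))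
    have hp := E.hasDerivAt_potential ht
    have ht' := (E.radius_pos (le_of_lt ht)).ne'
    refine ((hd.sub (hp.const_mul ε)).add ((hp.pow 2).const_mul δ)).congr_deriv ?_
    field_simp
    ring
  · filter_upwards [lt_mem_nhds hs] with t ht using E.radius_pos (le_of_lt ht)

/-- The maximum principle on `[0, R] × S¹`, compared with the potential. -/
theorem le_mul_potential (hu : E.IsHarmonic u) {M ε R : ℝ} (hM : ∀ p, u p ≤ M)
    (hu0 : ∀ p ∈ HalfCylinder.boundary, u p ≤ 0) (hε : 0 < ε) (hR : 0 ≤ R)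
    (hH : 0 < E.potential R) (hMR : 2 * M ≤ ε * E.potential R) {p : HalfCylinder}
    (hp : (p.1 : ℝ) ≤ R) : u p ≤ ε * E.potential p.1 := by
  -- With this `δ`, the perturbation at `s = R` is `-ε h(R) / 2`, which `2M ≤ ε h(R)` makes at most
  -- `-M`.
  set δ := ε / (2 * E.potential R) with hδ_def
  have hδ : 0 < δ := by positivity
  have hδH : δ * E.potential R = ε / 2 := by
    rw [hδ_def]
    field_simp
  set F : HalfCylinder → ℝ := fun p =>
    u p - ε * E.potential p.1 + δ * E.potential p.1 ^ 2 with hF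
  have hpc : Continuous fun p : HalfCylinder => E.potential p.1 :=
    E.continuousOn_potential.comp_continuous (continuous_subtype_val.comp continuous_fst)
      fun p => p.1.2
  have hFc : Continuous F :=
    (hu.continuous.sub (continuous_const.mul hpc)).add (continuous_const.mul (hpc.pow 2))
  have : Fact (0 < 2 * Real.pi) := ⟨by positivity⟩
  have : CompactSpace Real.Angle := inferInstanceAs (CompactSpace (AddCircle (2 * Real.pi)))
  have hK : IsCompact ((Iic (⟨R, hR⟩ : Ici (0 : ℝ))) ×ˢ (univ : Set Real.Angle)) := by
    refine IsCompact.prod ?_ isCompact_univ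
    rw [Subtype.isCompact_iff]
    convert isCompact_Icc (a := (0 : ℝ)) (b := R) using 1
    ext x
    constructor
    · rintro ⟨y, hy, rfl⟩
      exact ⟨y.2, hy⟩
    · intro hx
      exact ⟨⟨x, hx.1⟩, hx.2, rfl⟩
  obtain ⟨⟨s, θ⟩, ⟨hsR, -⟩, hmax⟩ := hK.exists_isMaxOn ⟨p, hp, mem_univ _⟩ hFc.continuousOn
  have hsR' : (s : ℝ) ≤ R := hsR
  have hF0 : F (s, θ) ≤ 0 := by
    rcases (show (0 : ℝ) ≤ s from s.2).eq_or_lt with h0 | h0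
    · have := hu0 (s, θ) h0.symm
      simp only [hF, ← h0, E.potential_zero]
      linarith
    rcases hsR'.eq_or_lt with h1 | h1
    · have := hM (s, θ)
      simp only [hF, h1]
      nlinarith
    exfalso
    obtain ⟨t, rfl⟩ : ∃ t : ℝ, (t : Real.Angle) = θ := QuotientAddGroup.mk_surjective θ
    refine hu.not_isLocalMax (s := s) (θ := t) (ε := ε) h0 hδ ?_
    -- Near an interior point the chart stays in `[0, R] × S¹`, so the maximum there is a local one
    -- for the lifted function.
    have hnear : ∀ᶠ q : ℝ × ℝ in 𝓝 ((s : ℝ), t), 0 < q.1 ∧ q.1 < R :=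
      (eventually_fst_pos h0).and
        (continuous_fst.continuousAt.eventually (Iio_mem_nhds h1))
    filter_upwards [hnear] with q hq
    have h := hmax (a := (⟨q.1, hq.1.le⟩, (q.2 : Real.Angle))) ⟨hq.2.le, mem_univ _⟩
    have e1 := HalfCylinder.lift_coe u ⟨q.1, hq.1.le⟩ q.2
    have e2 := HalfCylinder.lift_coe u s t
    rw [e2]
    change HalfCylinder.lift u q = _ at e1
    rw [e1]
    exact h
  have hle : F p ≤ 0 := (hmax ⟨hp, mem_univ _⟩).trans hF0
  have : 0 ≤ δ * E.potential p.1 ^ 2 := by positivity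
  simp only [hF] at hle
  linarith

theorem nonpos_of_boundary (hu : E.IsHarmonic u) {M : ℝ} (hM : ∀ p, u p ≤ M)
    (hu0 : ∀ p ∈ HalfCylinder.boundary, u p ≤ 0)
    (hpot : ∀ N s : ℝ, ∃ R, s ≤ R ∧ 0 ≤ R ∧ N ≤ E.potential R) (p : HalfCylinder) :
    u p ≤ 0 := by
  by_contra! hp
  have hp0 := E.potential_nonneg p.1.2
  -- Then `ε (h(p) + 1) = u(p) / 2`, so `u(p) ≤ ε h(p)` is impossible.
  set ε := u p / (E.potential p.1 + 1) / 2 with hε_def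
  have hε : 0 < ε := by positivity
  -- The bound `1` makes `h(R)` positive; the other gives `2M ≤ ε h(R)`.
  obtain ⟨R, hpR, hR, hN⟩ := hpot (max 1 (2 * M / ε)) p.1
  have hMR : 2 * M ≤ ε * E.potential R := by
    rw [← div_le_iff₀' hε]
    exact (le_max_right _ _).trans hN
  have h := hu.le_mul_potential hM hu0 hε hR
    (lt_of_lt_of_le one_pos ((le_max_left _ _).trans hN)) hMR hpR
  have hεp : ε * (E.potential p.1 + 1) * 2 = u p := by
    rw [hε_def]
    field_simp
  nlinarith [mul_nonneg hε.le hp0]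

end IsHarmonic

end EndOfRevolution

theorem mainTheorem9 (E : EndOfRevolution) (c : ℝ) (hc : 0 < c)
    (hI : volume (E.aboveCone c) = ⊤) : E.IsParabolic := by
  have main : ∀ u v : HalfCylinder → ℝ,
      E.IsHarmonic u → (∃ C : ℝ, ∀ p, |u p| ≤ C) →
      E.IsHarmonic v → (∃ C : ℝ, ∀ p, |v p| ≤ C) →
      EqOn u v HalfCylinder.boundary → u ≤ v := by
    rintro u v hu ⟨C, hC⟩ hv ⟨D, hD⟩ huv p
    have h := (hu.sub hv).nonpos_of_boundary (M := C + D)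
      (fun q => by
        have h1 := (abs_le.1 (hC q)).2
        have h2 := (abs_le.1 (hD q)).1
        simp only [Pi.sub_apply]
        linarith)
      (fun q hq => (sub_eq_zero.2 (huv hq)).le) (E.exists_le_potential hc hI) p
    exact sub_nonpos.1 h
  intro u v hu hC hv hD huv
  exact le_antisymm (main u v hu hC hv hD huv) (main v u hv hD hu hC huv.symm)
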